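/- Call a non-negative function $h$ on $\mathbb{R}$ log-concave if $h((1-\lambda)x+\lambda y)\ge h(x)^{1-\lambda}h(y)^{\lambda}$ for all $x,y\in\mathbb{R}$ and $\lambda\in(0,1)$. Theorem (stability of the one-dimensional Prékopa–Leindler inequality). There exists a positive absolute constant $c$ with the following property. Let $\varepsilon>0$ with $\varepsilon\le\frac12$ or $\varepsilon\ge 2$, and let $m,f,g$ be non-negative integrable functions on $\mathbb{R}$ with positive integrals such that $m$ is log-concave, $m\left(\frac{r+s}{2}\right)\ge\sqrt{f(r)g(s)}$ for all $r,s\in\mathbb{R}$, and $$\int_{\mathbb{R}}m\le(1+\varepsilon)\sqrt{\int_{\mathbb{R}}f\cdot\int_{\mathbb{R}}g}.$$ Then there exist $a>0$ and $b\in\mathbb{R}$ such that $$\int_{\mathbb{R}}|f(t)-a\,m(t+b)|\,dt\le c\cdot\sqrt[3]{\varepsilon}\,|\ln\varepsilon|^{4/3}\cdot a\int_{\mathbb{R}}m(t)\,dt,$$ $$\int_{\mathbb{R}}|g(t)-a^{-1}m(t-b)|\,dt\le c\cdot\sqrt[3]{\varepsilon}\,|\ln\varepsilon|^{4/3}\cdot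 a^{-1}\int_{\mathbb{R}}m(t)\,dt.$$ -/

import Mathlib

open MeasureTheory

/-- A non-negative function `h : ℝ → ℝ` is log-concave if
`h ((1 - l) x + l y) ≥ h x ^ (1 - l) * h y ^ l` for all real `x`, `y` and `l ∈ (0, 1)`.
Since both exponents are positive, the right-hand side vanishes where `h x = 0` or `h y = 0`. -/
def LogConcaveFun (h : ℝ → ℝ) : Prop :=
  (∀ x : ℝ, 0 ≤ h x) ∧
    ∀ x y l : ℝ, 0 < l → l < 1 →
      h x ^ (1 - l) * h y ^ l ≤ h ((1 - l) * x + l * y)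

/-! Scale `f` and `g` to have supremum one and `m` by the matching geometric mean, and parametrise
levels by `exp (-u)`. Let P, Q, R be the right endpoints of the superlevel sets of `f`, `g`, `m`,
and P', Q', R' those of the reflected functions. Multiplying levels adds parameters, so the
hypothesis becomes P u + Q v ≤ 2 R ((u + v) / 2), and likewise for the primed functions. Integrating
u = v against exp (-u) du gives (∫f + ∫g) / 2 ≤ ∫m. Near-equality makes the deficits R - (P + Q) / 2
and R' - (P' + Q') / 2 of total weighted integral at most ε ∫m.

The freedom u ≠ v gives stability. With u = w + h, v = w - h, integrated in w, it forces P - Q to be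
almost constant: the error is h times an increment of P + Q, plus deficit / h
(`exists_lintegral_exp_neg_mul_abs_sub_le`). Choosing h = √ε gives P - Q ≈ κ and P' - Q' ≈ κ' with
error of order √ε. Since ∫f and ∫g are close, κ + κ' ≈ 0, so the superlevel sets of `f` and `g` lie
almost inside translates of those of `m`, by opposite shifts. The layer-cake formula turns this into
an L¹ estimate (`half_add_le_integral_and_stability`).

Log-concavity of `m` serves only to make superlevel sets intervals and `m` bounded. The order √ε
obtained for small ε is stronger than the cube root claimed; the logarithmic factor is merely
bounded below. -/

/-! ### Midpoint inequalities between monotone functions on the half-line -/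

open Set in
theorem MonotoneOn.intervalIntegrable_of_pos {p : ℝ → ℝ} (hp : MonotoneOn p (Ioi 0)) {u v : ℝ}
    (hu : 0 < u) (hv : 0 < v) : IntervalIntegrable p volume u v :=
  (hp.mono fun _ hx => lt_of_lt_of_le (lt_min hu hv) hx.1).intervalIntegrable

-- Integrating p (w + h) + q (w - h) ≤ 2 r w over [u, v] shifts the two integrals in opposite
-- directions. What survives are integrals over end intervals of length h, which monotonicity
-- compares with endpoint values; division by h gives the 2 / h.
open Set in
theorem sub_le_sub_add_integral_of_monotoneOn {p q r : ℝ → ℝ} (hp : MonotoneOn p (Ioi 0))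
    (hq : MonotoneOn q (Ioi 0)) (hr : MonotoneOn r (Ioi 0))
    (hpq : ∀ u v, 0 < u → 0 < v → p u + q v ≤ 2 * r ((u + v) / 2)) {h u v : ℝ} (h0 : 0 < h)
    (hu : h < u) (huv : u ≤ v) :
    p v - q v ≤ p u - q u + (p (u + h) - p u) + (q u - q (u - h)) +
      2 / h * ∫ w in u..v, (r w - (p w + q w) / 2) := by
  have hI {f : ℝ → ℝ} (hf : MonotoneOn f (Ioi 0)) {a b : ℝ} (ha : 0 < a) (hb : 0 < b) :
      IntervalIntegrable f volume a b := hf.intervalIntegrable_of_pos ha hb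
  have u0 : 0 < u := h0.trans hu
  have v0 : 0 < v := u0.trans_le huv
  have i1 : IntervalIntegrable (fun w => p (w + h)) volume u v := by
    have := (hI hp (a := u + h) (b := v + h) (by linarith) (by linarith)).comp_add_right h
    simpa using this
  have i2 : IntervalIntegrable (fun w => q (w - h)) volume u v := by
    have := (hI hq (a := u - h) (b := v - h) (by linarith) (by linarith)).comp_sub_right h
    simpa using this
  have ip := hI hp u0 v0
  have iq := hI hq u0 v0
  have ir := hI hr u0 v0
  have key : ∫ w in u..v, (p (w + h) + q (w - h)) ≤
      ∫ w in u..v, (p w + q w + 2 * (r w - (p w + q w) / 2)) := by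
    refine intervalIntegral.integral_mono_on huv (i1.add i2)
      ((ip.add iq).add ((ir.sub ((ip.add iq).div_const 2)).const_mul 2)) fun w hw => ?_
    have hw1 : h < w := hu.trans_le hw.1
    have := hpq (w + h) (w - h) (by linarith) (by linarith)
    rw [show (w + h + (w - h)) / 2 = w by ring] at this
    linarith
  rw [intervalIntegral.integral_add i1 i2,
    intervalIntegral.integral_add (ip.add iq) ((ir.sub ((ip.add iq).div_const 2)).const_mul 2),
    intervalIntegral.integral_add ip iq, intervalIntegral.integral_const_mul,
    intervalIntegral.integral_comp_add_right (fun w => p w),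
    intervalIntegral.integral_comp_sub_right (fun w => q w)] at key
  set J := ∫ w in u..v, (r w - (p w + q w) / 2)
  -- The shifted and unshifted integrals share their middle part, so only the end pieces remain.
  have e1 := intervalIntegral.integral_add_adjacent_intervals
    (hI hp u0 (b := u + h) (by linarith)) (hI hp (a := u + h) (b := v + h) (by linarith) (by linarith))
  have e2 := intervalIntegral.integral_add_adjacent_intervals
    (hI hp u0 v0) (hI hp v0 (b := v + h) (by linarith))
  have e3 := intervalIntegral.integral_add_adjacent_intervals
    (hI hq (a := u - h) (b := u) (by linarith) u0) (hI hq u0 v0)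
  have e4 := intervalIntegral.integral_add_adjacent_intervals
    (hI hq (a := u - h) (b := v - h) (by linarith) (by linarith))
    (hI hq (a := v - h) (b := v) (by linarith) v0)
  have lower {f : ℝ → ℝ} (hf : MonotoneOn f (Ioi 0)) {a : ℝ} (ha : 0 < a) :
      h * f a ≤ ∫ w in a..(a + h), f w := by
    have := intervalIntegral.integral_mono_on (a := a) (b := a + h) (μ := volume) (by linarith)
      (by simp) (hI hf ha (b := a + h) (by linarith)) (f := fun _ => f a)
      (fun w hw => hf ha (ha.trans_le hw.1) hw.1)
    simpa using this
  have upper {f : ℝ → ℝ} (hf : MonotoneOn f (Ioi 0)) {a : ℝ} (ha : 0 < a) :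
      ∫ w in a..(a + h), f w ≤ h * f (a + h) := by
    have := intervalIntegral.integral_mono_on (a := a) (b := a + h) (μ := volume) (by linarith)
      (hI hf ha (b := a + h) (by linarith)) (by simp) (g := fun _ => f (a + h))
      (fun w hw => hf (ha.trans_le hw.1) (show (0 : ℝ) < a + h by linarith) hw.2)
    simpa using this
  have l1 := lower hp v0
  have l2 := upper hp u0
  have l3 := lower hq (a := u - h) (by linarith)
  have l4 := upper hq (a := v - h) (by linarith)
  simp only [sub_add_cancel] at l3 l4
  have : h * (p v - p (u + h)) ≤ h * (q v - q (u - h)) + 2 * J := by linarith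
  have h2 : 2 / h * J = (2 * J) / h := by ring
  have : p v - p (u + h) ≤ q v - q (u - h) + 2 / h * J := by
    rw [h2, ← sub_le_iff_le_add', le_div_iff₀ h0]; linarith
  linarith

-- The hypothesis is symmetric in p and q, so the one-sided bound applies both ways; both one-sided
-- increments are dominated by the increment of p + q over [u - h, u + h].
open Set in
theorem abs_sub_sub_le_of_monotoneOn {p q r : ℝ → ℝ} (hp : MonotoneOn p (Ioi 0))
    (hq : MonotoneOn q (Ioi 0)) (hr : MonotoneOn r (Ioi 0))
    (hpq : ∀ u v, 0 < u → 0 < v → p u + q v ≤ 2 * r ((u + v) / 2)) {h u v : ℝ} (h0 : 0 < h)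
    (hu : h < u) (huv : u ≤ v) :
    |(p v - q v) - (p u - q u)| ≤ (p (u + h) + q (u + h) - (p (u - h) + q (u - h))) +
      2 / h * ∫ w in u..v, (r w - (p w + q w) / 2) := by
  have a1 := sub_le_sub_add_integral_of_monotoneOn hp hq hr hpq h0 hu huv
  have a2 := sub_le_sub_add_integral_of_monotoneOn hq hp hr
    (fun u v hu hv => by rw [add_comm, add_comm u]; exact hpq v u hv hu) h0 hu huv
  simp only [add_comm (q _) (p _)] at a2
  have u0 : 0 < u := h0.trans hu
  have m1 {f : ℝ → ℝ} (hf : MonotoneOn f (Ioi 0)) : f u ≤ f (u + h) :=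
    hf u0 (show (0 : ℝ) < u + h by linarith) (by linarith)
  have m2 {f : ℝ → ℝ} (hf : MonotoneOn f (Ioi 0)) : f (u - h) ≤ f u :=
    hf (show (0 : ℝ) < u - h by linarith) u0 (by linarith)
  have := m1 hp; have := m1 hq; have := m2 hp; have := m2 hq
  rw [abs_le]; constructor <;> linarith

-- Tonelli, together with the fact that exp (-v) integrates to exp (-w) over v > w.
open Set in
theorem lintegral_exp_neg_mul_lintegral_Ioc {d : ℝ → ENNReal} {c : ℝ}
    (hd : AEMeasurable d (volume.restrict (Ioi c))) :
    ∫⁻ v in Ioi c, ENNReal.ofReal (Real.exp (-v)) * ∫⁻ w in Ioc c v, d w =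
      ∫⁻ w in Ioi c, ENNReal.ofReal (Real.exp (-w)) * d w := by
  have e (v : ℝ) : ENNReal.ofReal (Real.exp (-v)) * ∫⁻ w in Ioc c v, d w =
      ∫⁻ w in Ioi c, ENNReal.ofReal (Real.exp (-v)) * (Iic v).indicator d w := by
    rw [lintegral_const_mul'' _ (hd.indicator measurableSet_Iic),
      lintegral_indicator measurableSet_Iic, Measure.restrict_restrict measurableSet_Iic,
      inter_comm, Ioi_inter_Iic]
  simp only [e]
  rw [lintegral_lintegral_swap]
  · refine setLIntegral_congr_fun measurableSet_Ioi fun w hw => ?_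
    have e2 (v : ℝ) : ENNReal.ofReal (Real.exp (-v)) * (Iic v).indicator d w =
        (Ici w).indicator (fun v => ENNReal.ofReal (Real.exp (-v))) v * d w := by
      by_cases hv : w ≤ v <;> simp [hv]
    simp only [e2]
    rw [lintegral_mul_const _ (by measurability), lintegral_indicator measurableSet_Ici,
      Measure.restrict_restrict measurableSet_Ici, inter_eq_left.2 (Ici_subset_Ioi.2 hw),
      setLIntegral_congr Ioi_ae_eq_Ici.symm,
      ← ofReal_integral_eq_lintegral_ofReal (integrableOn_exp_neg_Ioi w)
        (Filter.Eventually.of_forall fun _ => (Real.exp_pos _).le), integral_exp_neg_Ioi]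
  · have h1 : AEMeasurable (fun z : ℝ × ℝ => d z.2)
        ((volume.restrict (Ioi c)).prod (volume.restrict (Ioi c))) := hd.comp_snd
    have h2 : (Function.uncurry fun v w : ℝ =>
        ENNReal.ofReal (Real.exp (-v)) * (Iic v).indicator d w) =
        fun z : ℝ × ℝ => ENNReal.ofReal (Real.exp (-z.1)) *
          ({z : ℝ × ℝ | z.2 ≤ z.1}.indicator (fun z => d z.2) z) := by
      ext z
      by_cases hz : z.2 ≤ z.1 <;> simp [Function.uncurry, hz]
    rw [h2]
    exact (by fun_prop : Measurable fun z : ℝ × ℝ => ENNReal.ofReal (Real.exp (-z.1))).aemeasurable.mul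
      (h1.indicator (measurableSet_le measurable_snd measurable_fst))

-- The integral telescopes to two windows of length 2h, around 2 and around a. The point 3 appears
-- because 2 + h ≤ 3.
open Set in
theorem integral_comp_add_sub_comp_sub_le {S : ℝ → ℝ} (hS : MonotoneOn S (Ioi 0)) {S0 A h a : ℝ}
    (hS0 : ∀ u, 0 < u → S0 ≤ S u) (hA : S 3 - S0 ≤ A) (h0 : 0 < h) (h1 : h ≤ 1 / 2) (ha : h < a) :
    IntervalIntegrable (fun u => S (u + h) - S (u - h)) volume a 2 ∧
      ∫ u in a..2, (S (u + h) - S (u - h)) ≤ 2 * h * A := by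
  have hI {a b : ℝ} (ha : 0 < a) (hb : 0 < b) :
      IntervalIntegrable S volume a b := hS.intervalIntegrable_of_pos ha hb
  have i1 : IntervalIntegrable (fun w => S (w + h)) volume a 2 := by
    have := (hI (a := a + h) (b := 2 + h) (by linarith) (by linarith)).comp_add_right h
    simpa using this
  have i2 : IntervalIntegrable (fun w => S (w - h)) volume a 2 := by
    have := (hI (a := a - h) (b := 2 - h) (by linarith) (by linarith)).comp_sub_right h
    simpa using this
  refine ⟨i1.sub i2, ?_⟩
  rw [intervalIntegral.integral_sub i1 i2,
    intervalIntegral.integral_comp_add_right (fun w => S w),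
    intervalIntegral.integral_comp_sub_right (fun w => S w)]
  have e1 := intervalIntegral.integral_add_adjacent_intervals
    (hI (a := a - h) (b := a + h) (by linarith) (by linarith))
    (hI (a := a + h) (b := 2 + h) (by linarith) (by linarith))
  have e2 := intervalIntegral.integral_add_adjacent_intervals
    (hI (a := a - h) (b := 2 - h) (by linarith) (by linarith))
    (hI (a := 2 - h) (b := 2 + h) (by linarith) (by linarith))
  have l1 := intervalIntegral.integral_mono_on (a := a - h) (b := a + h) (μ := volume) (by linarith)
    (by simp) (hI (by linarith) (by linarith)) (f := fun _ => S0)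
    (fun w hw => hS0 w (by linarith [hw.1]))
  have l2 := intervalIntegral.integral_mono_on (a := 2 - h) (b := 2 + h) (μ := volume) (by linarith)
    (hI (by linarith) (by linarith)) (by simp) (g := fun _ => S 3)
    (fun w hw => hS (show (0 : ℝ) < w by linarith [hw.1]) (show (0 : ℝ) < 3 by norm_num)
      (by linarith [hw.2]))
  simp only [intervalIntegral.integral_const, smul_eq_mul] at l1 l2
  nlinarith [mul_le_mul_of_nonneg_left hA h0.le]

-- The constant is the value of p - q at a point c where p + q has a small increment. To the left of
-- c the comparison is anchored at the variable point u, whose increments are small on average; to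
-- the right it is anchored at c itself.
open Set in
theorem exists_lintegral_exp_neg_mul_abs_sub_le {p q r : ℝ → ℝ} (hp : MonotoneOn p (Ioi 0))
    (hq : MonotoneOn q (Ioi 0)) (hr : MonotoneOn r (Ioi 0))
    (hpq : ∀ u v, 0 < u → 0 < v → p u + q v ≤ 2 * r ((u + v) / 2)) {S0 A η h : ℝ}
    (hS0 : ∀ u, 0 < u → S0 ≤ p u + q u) (hA : p 3 + q 3 - S0 ≤ A) (h0 : 0 < h) (h1 : h ≤ 1 / 2)
    (η0 : 0 ≤ η) (hη : ∫⁻ u in Ioi 0, ENNReal.ofReal (Real.exp (-u)) *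
      ENNReal.ofReal (r u - (p u + q u) / 2) ≤ ENNReal.ofReal η) :
    ∃ κ : ℝ, ∫⁻ u in Ioi 0, ENNReal.ofReal (Real.exp (-u) * |p u - q u - κ|) ≤
      ENNReal.ofReal (6 * (h * A) + 40 * (η / h)) := by
  have hS : MonotoneOn (fun u => p u + q u) (Ioi 0) := hp.add hq
  set d : ℝ → ℝ := fun u => r u - (p u + q u) / 2 with hd
  have d0 (u : ℝ) (hu : 0 < u) : 0 ≤ d u := by
    have := hpq u u hu hu
    rw [show (u + u) / 2 = u by ring] at this
    simp only [hd]; linarith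
  have hdI {a b : ℝ} (ha : 0 < a) (hb : 0 < b) : IntervalIntegrable d volume a b :=
    (hr.intervalIntegrable_of_pos ha hb).sub
      (((hp.intervalIntegrable_of_pos ha hb).add (hq.intervalIntegrable_of_pos ha hb)).div_const 2)
  have dm : AEMeasurable d (volume.restrict (Ioi 0)) :=
    (aemeasurable_restrict_of_monotoneOn measurableSet_Ioi hr).sub
      ((aemeasurable_restrict_of_monotoneOn measurableSet_Ioi hS).div_const 2)
  have A0 : 0 ≤ A := by linarith [hS0 3 (by norm_num)]
  -- A good c exists because the increment is at most 2hA on average over [1, 2].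
  obtain ⟨c, hc, hTc⟩ : ∃ c ∈ Icc (1 : ℝ) 2,
      (p (c + h) + q (c + h)) - (p (c - h) + q (c - h)) ≤ 2 * h * A := by
    obtain ⟨hi, hle⟩ := integral_comp_add_sub_comp_sub_le hS hS0 hA h0 h1 (a := 1)
      (by linarith)
    obtain ⟨c, hc, hc'⟩ := exists_le_setAverage (μ := volume) (s := Ioc (1 : ℝ) 2)
      (by norm_num [Real.volume_Ioc]) (by simp)
      ((intervalIntegrable_iff_integrableOn_Ioc_of_le (by norm_num)).1 hi)
    refine ⟨c, Ioc_subset_Icc_self hc, hc'.trans ?_⟩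
    rw [setAverage_eq, ← intervalIntegral.integral_of_le (by norm_num)]
    norm_num [Measure.real] at hle ⊢
    exact hle
  have c1 : 1 ≤ c := hc.1
  have c2 : c ≤ 2 := hc.2
  -- bound of the integral of the deficit over a bounded interval
  have hJ {u : ℝ} (hu : 0 < u) (huc : u ≤ c) : ∫ w in u..c, d w ≤ 8 * η := by
    rw [intervalIntegral.integral_of_le huc, integral_eq_lintegral_of_nonneg_ae]
    · refine ENNReal.toReal_le_of_le_ofReal (by positivity) ?_
      rw [ENNReal.ofReal_mul (by norm_num)]
      calc ∫⁻ w in Ioc u c, ENNReal.ofReal (d w)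
          ≤ ∫⁻ w in Ioc u c, ENNReal.ofReal 8 *
              (ENNReal.ofReal (Real.exp (-w)) * ENNReal.ofReal (d w)) := by
            refine setLIntegral_mono_ae' measurableSet_Ioc (Filter.Eventually.of_forall fun w hw => ?_)
            rw [← ENNReal.ofReal_mul (Real.exp_pos _).le, ← ENNReal.ofReal_mul (by norm_num)]
            refine ENNReal.ofReal_le_ofReal ?_
            have h8 : 1 ≤ 8 * Real.exp (-w) := by
              have h3 : Real.exp 2 ≤ 8 := by
                have := Real.exp_one_lt_d9
                have h2 : Real.exp 2 = Real.exp 1 * Real.exp 1 := by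
                  rw [← Real.exp_add]; norm_num
                nlinarith [Real.exp_pos 1]
              have h4 : Real.exp w ≤ 8 := (Real.exp_le_exp.2 (hw.2.trans c2)).trans h3
              rw [Real.exp_neg, ← div_eq_mul_inv, le_div_iff₀ (Real.exp_pos _)]
              linarith
            nlinarith [d0 w (hu.trans hw.1)]
        _ ≤ ∫⁻ w in Ioi 0, ENNReal.ofReal 8 *
              (ENNReal.ofReal (Real.exp (-w)) * ENNReal.ofReal (d w)) :=
            lintegral_mono_set fun w hw => hu.trans hw.1
        _ ≤ _ := by
            rw [lintegral_const_mul' _ _ ENNReal.ofReal_ne_top]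
            gcongr
    · exact (ae_restrict_iff' measurableSet_Ioc).2
        (Filter.Eventually.of_forall fun w hw => d0 w (hu.trans hw.1))
    · exact ((intervalIntegrable_iff_integrableOn_Ioc_of_le huc).1
        (hdI hu (by linarith))).aestronglyMeasurable
  refine ⟨p c - q c, ?_⟩
  have hle1 (u : ℝ) (hu : 0 < u) : Real.exp (-u) ≤ 1 := Real.exp_le_one_iff.2 (by linarith)
  -- Near 0 there is no room for a step h to the left; the crude bound A on an interval of length 2h
  -- suffices.
  have R1 : ∫⁻ u in Ioc 0 (2 * h), ENNReal.ofReal (Real.exp (-u) * |p u - q u - (p c - q c)|) ≤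
      ENNReal.ofReal (2 * h * A) := by
    calc _ ≤ ∫⁻ u in Ioc 0 (2 * h), ENNReal.ofReal A := by
          refine setLIntegral_mono_ae' measurableSet_Ioc (Filter.Eventually.of_forall fun u hu => ?_)
          refine ENNReal.ofReal_le_ofReal ?_
          refine (mul_le_of_le_one_left (abs_nonneg _) (hle1 u hu.1)).trans ?_
          have u0 : u ∈ Ioi (0 : ℝ) := hu.1
          have c0 : c ∈ Ioi (0 : ℝ) := show (0 : ℝ) < c by linarith
          have i3 : (3 : ℝ) ∈ Ioi (0 : ℝ) := show (0 : ℝ) < 3 by norm_num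
          have uc : u ≤ c := by linarith [hu.2]
          have := hp u0 c0 uc; have := hq u0 c0 uc
          have := hp c0 i3 (by linarith); have := hq c0 i3 (by linarith)
          have := hS0 u hu.1
          rw [abs_le]; constructor <;> linarith
      _ = _ := by
          rw [setLIntegral_const, Real.volume_Ioc, ← ENNReal.ofReal_mul A0]
          congr 1; ring
  have R2 : ∫⁻ u in Ioc (2 * h) c, ENNReal.ofReal (Real.exp (-u) * |p u - q u - (p c - q c)|) ≤
      ENNReal.ofReal (2 * h * A + 32 * (η / h)) := by
    obtain ⟨hi, hle⟩ := integral_comp_add_sub_comp_sub_le hS hS0 hA h0 h1 (a := 2 * h)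
      (by linarith)
    have hi' := ((intervalIntegrable_iff_integrableOn_Ioc_of_le (by linarith)).1 hi)
    have T0 (u : ℝ) (hu : h < u) : 0 ≤ p (u + h) + q (u + h) - (p (u - h) + q (u - h)) :=
      sub_nonneg.2 (hS (show 0 < u - h by linarith) (show 0 < u + h by linarith) (by linarith))
    calc _ ≤ ∫⁻ u in Ioc (2 * h) c, (ENNReal.ofReal
            (p (u + h) + q (u + h) - (p (u - h) + q (u - h))) + ENNReal.ofReal (16 * (η / h))) := by
          refine setLIntegral_mono_ae' measurableSet_Ioc (Filter.Eventually.of_forall fun u hu => ?_)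
          have hu1 : h < u := by linarith [hu.1]
          rw [← ENNReal.ofReal_add (T0 u hu1) (by positivity)]
          refine ENNReal.ofReal_le_ofReal ?_
          refine (mul_le_of_le_one_left (abs_nonneg _) (hle1 u (h0.trans hu1))).trans ?_
          rw [abs_sub_comm]
          refine (abs_sub_sub_le_of_monotoneOn hp hq hr hpq h0 hu1 hu.2).trans ?_
          have := mul_le_mul_of_nonneg_left (hJ (h0.trans hu1) hu.2)
            (show 0 ≤ 2 / h by positivity)
          have e : 2 / h * (8 * η) = 16 * (η / h) := by ring
          simp only [hd] at this
          linarith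
      _ ≤ ∫⁻ u in Ioc (2 * h) 2, (ENNReal.ofReal
            (p (u + h) + q (u + h) - (p (u - h) + q (u - h))) + ENNReal.ofReal (16 * (η / h))) :=
          lintegral_mono_set (Ioc_subset_Ioc_right c2)
      _ ≤ _ := by
          rw [lintegral_add_right _ measurable_const, setLIntegral_const, Real.volume_Ioc,
            ← ofReal_integral_eq_lintegral_ofReal hi', ← ENNReal.ofReal_mul (by positivity),
            ← ENNReal.ofReal_add, ← intervalIntegral.integral_of_le (by linarith)]
          · refine ENNReal.ofReal_le_ofReal (add_le_add hle ?_)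
            have : 0 ≤ η / h := by positivity
            nlinarith
          · exact setIntegral_nonneg measurableSet_Ioc fun u hu => T0 u (by linarith [hu.1])
          · exact mul_nonneg (by positivity) (by linarith)
          · exact (ae_restrict_iff' measurableSet_Ioc).2
              (Filter.Eventually.of_forall fun u hu => T0 u (by linarith [hu.1]))
  -- The deficit integral over (c, u] may grow with u; exchanging the order of integration restores
  -- the weighted integral bounded by η.
  have R3 : ∫⁻ u in Ioi c, ENNReal.ofReal (Real.exp (-u) * |p u - q u - (p c - q c)|) ≤
      ENNReal.ofReal (2 * h * A + 2 * (η / h)) := by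
    have dmc : AEMeasurable (fun u => ENNReal.ofReal (d u)) (volume.restrict (Ioi c)) :=
      (dm.mono_measure (Measure.restrict_mono
        (Ioi_subset_Ioi (by linarith)) le_rfl)).ennreal_ofReal
    calc _ ≤ ∫⁻ u in Ioi c, (ENNReal.ofReal (2 * h * A) * ENNReal.ofReal (Real.exp (-u)) +
            ENNReal.ofReal (2 / h) * (ENNReal.ofReal (Real.exp (-u)) *
              ∫⁻ w in Ioc c u, ENNReal.ofReal (d w))) := by
          refine setLIntegral_mono_ae' measurableSet_Ioi (Filter.Eventually.of_forall fun u hu => ?_)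
          have hu : c < u := hu
          have e : ∫⁻ w in Ioc c u, ENNReal.ofReal (d w) = ENNReal.ofReal (∫ w in c..u, d w) := by
            rw [intervalIntegral.integral_of_le hu.le, ofReal_integral_eq_lintegral_ofReal]
            · exact (intervalIntegrable_iff_integrableOn_Ioc_of_le hu.le).1
                (hdI (by linarith) (by linarith))
            · exact (ae_restrict_iff' measurableSet_Ioc).2
                (Filter.Eventually.of_forall fun w hw => d0 w (by linarith [hw.1]))
          have J0 : 0 ≤ ∫ w in c..u, d w :=
            intervalIntegral.integral_nonneg hu.le fun w hw => d0 w (by linarith [hw.1])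
          have E0 := Real.exp_pos (-u)
          rw [e, ← ENNReal.ofReal_mul (by positivity), ← ENNReal.ofReal_mul (by positivity),
            ← ENNReal.ofReal_mul (by positivity), ← ENNReal.ofReal_add (by positivity)
              (by positivity)]
          refine ENNReal.ofReal_le_ofReal ?_
          have := abs_sub_sub_le_of_monotoneOn hp hq hr hpq h0 (u := c) (by linarith) hu.le
          have h2 : |p u - q u - (p c - q c)| ≤ 2 * h * A + 2 / h * ∫ w in c..u, d w := by
            simp only [hd]; linarith
          calc _ ≤ Real.exp (-u) * (2 * h * A + 2 / h * ∫ w in c..u, d w) := by gcongr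
            _ = _ := by ring
      _ ≤ _ := by
          rw [lintegral_add_left (by fun_prop), lintegral_const_mul' _ _ ENNReal.ofReal_ne_top,
            lintegral_const_mul' _ _ ENNReal.ofReal_ne_top,
            lintegral_exp_neg_mul_lintegral_Ioc dmc,
            ← ofReal_integral_eq_lintegral_ofReal (integrableOn_exp_neg_Ioi c)
              (Filter.Eventually.of_forall fun _ => (Real.exp_pos _).le), integral_exp_neg_Ioi,
            ENNReal.ofReal_add (by positivity) (by positivity)]
          refine add_le_add ?_ ?_
          · rw [← ENNReal.ofReal_mul (by positivity)]
            exact ENNReal.ofReal_le_ofReal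
              (mul_le_of_le_one_right (by positivity) (hle1 c (by linarith)))
          · rw [show 2 * (η / h) = 2 / h * η by ring, ENNReal.ofReal_mul (by positivity)]
            gcongr
            exact (lintegral_mono_set (Ioi_subset_Ioi (by linarith))).trans hη
  have hU : Ioi (0 : ℝ) = Ioc 0 (2 * h) ∪ (Ioc (2 * h) c ∪ Ioi c) := by
    rw [Ioc_union_Ioi_eq_Ioi (by linarith), Ioc_union_Ioi_eq_Ioi (by linarith)]
  rw [hU]
  refine (lintegral_union_le _ _ _).trans ((add_le_add le_rfl (lintegral_union_le _ _ _)).trans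
    ((add_le_add R1 (add_le_add R2 R3)).trans ?_))
  rw [← ENNReal.ofReal_add (by positivity) (by positivity),
    ← ENNReal.ofReal_add (by positivity) (by positivity)]
  refine ENNReal.ofReal_le_ofReal ?_
  have : 0 ≤ η / h := by positivity
  nlinarith

/-! ### Layer-cake formula in the logarithmic level variable -/

/-- The measure on `(0, ∞)` with density `exp (-u)`. -/
noncomputable def expDecay : Measure ℝ :=
  (volume.restrict (Set.Ioi 0)).withDensity fun u => ENNReal.ofReal (Real.exp (-u))

theorem lintegral_expDecay (φ : ℝ → ENNReal) :
    ∫⁻ u, φ u ∂expDecay = ∫⁻ u in Set.Ioi 0, ENNReal.ofReal (Real.exp (-u)) * φ u := by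
  rw [expDecay, lintegral_withDensity_eq_lintegral_mul_non_measurable _ (by fun_prop)
    (Filter.Eventually.of_forall fun _ => ENNReal.ofReal_lt_top)]
  rfl

theorem ae_expDecay_pos : ∀ᵐ u ∂expDecay, 0 < u :=
  (withDensity_absolutelyContinuous _ _).ae_le (ae_restrict_mem measurableSet_Ioi)

instance : IsProbabilityMeasure expDecay where
  measure_univ := by
    rw [← lintegral_one, lintegral_expDecay]
    simp only [mul_one]
    rw [← ofReal_integral_eq_lintegral_ofReal (integrableOn_exp_neg_Ioi 0)
        (Filter.Eventually.of_forall fun _ => (Real.exp_pos _).le), integral_exp_neg_Ioi]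
    simp

theorem MonotoneOn.aestronglyMeasurable_expDecay {p : ℝ → ℝ} (hp : MonotoneOn p (Set.Ioi 0)) :
    AEStronglyMeasurable p expDecay :=
  ((aemeasurable_restrict_of_monotoneOn measurableSet_Ioi hp).mono_ac
    (withDensity_absolutelyContinuous _ _)).aestronglyMeasurable

theorem setLIntegral_Ioo_zero_one_eq_lintegral_expDecay (φ : ℝ → ENNReal) :
    ∫⁻ t in Set.Ioo 0 1, φ t = ∫⁻ u, φ (Real.exp (-u)) ∂expDecay := by
  have himg : (fun u : ℝ => Real.exp (-u)) '' Set.Ioi 0 = Set.Ioo 0 1 := by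
    ext t
    constructor
    · rintro ⟨u, hu, rfl⟩
      exact ⟨Real.exp_pos _, by simpa using hu⟩
    · rintro ⟨h0, h1⟩
      exact ⟨-Real.log t, neg_pos.2 (Real.log_neg h0 h1), by simp [Real.exp_log h0]⟩
  rw [lintegral_expDecay, ← himg, lintegral_image_eq_lintegral_abs_deriv_mul measurableSet_Ioi
    (f' := fun u => -Real.exp (-u))]
  · simp [abs_of_pos (Real.exp_pos _)]
  · intro u _
    have := (hasDerivAt_neg u).exp
    simpa using this.hasDerivWithinAt
  · intro u _ v _ h
    simpa using h

theorem integrable_and_integral_le_of_lintegral_le {α : Type*} [MeasurableSpace α] {μ : Measure α}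
    {φ : α → ℝ} {c : ℝ} (hφ : AEStronglyMeasurable φ μ) (h0 : 0 ≤ᵐ[μ] φ) (hc : 0 ≤ c)
    (h : ∫⁻ a, ENNReal.ofReal (φ a) ∂μ ≤ ENNReal.ofReal c) :
    Integrable φ μ ∧ ∫ a, φ a ∂μ ≤ c := by
  refine ⟨⟨hφ, (hasFiniteIntegral_iff_ofReal h0).2 (h.trans_lt ENNReal.ofReal_lt_top)⟩, ?_⟩
  rw [integral_eq_lintegral_of_nonneg_ae h0 hφ]
  exact ENNReal.toReal_le_of_le_ofReal hc h

/-- The superlevel sets of min f m are intersections, so those of f exceed them by the set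
difference. As f ≤ 1, only levels in (0, 1) matter, even if m exceeds 1. -/
theorem integral_le_integral_min_add_of_volume_sdiff_le {f m E : ℝ → ℝ} (hf0 : ∀ x, 0 ≤ f x)
    (hf1 : ∀ x, f x ≤ 1) (hf : Integrable f) (hm0 : ∀ x, 0 ≤ m x) (hm : Integrable m)
    (hE : Integrable E expDecay) (hE0 : ∀ u, 0 < u → 0 ≤ E u)
    (h : ∀ u, 0 < u → volume ({x | Real.exp (-u) < f x} \ {x | Real.exp (-u) < m x}) ≤
      ENNReal.ofReal (E u)) :
    ∫ x, f x ≤ (∫ x, min (f x) (m x)) + ∫ u, E u ∂expDecay := by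
  have hmin0 (x : ℝ) : 0 ≤ min (f x) (m x) := le_min (hf0 x) (hm0 x)
  have hmin : Integrable fun x => min (f x) (m x) := hf.inf hm
  have E0 : 0 ≤ᵐ[expDecay] E := ae_expDecay_pos.mono hE0
  have i1 : 0 ≤ ∫ x, min (f x) (m x) := integral_nonneg hmin0
  have i2 : 0 ≤ ∫ u, E u ∂expDecay := integral_nonneg_of_ae E0
  refine (ENNReal.ofReal_le_ofReal_iff (add_nonneg i1 i2)).1 ?_
  rw [ENNReal.ofReal_add i1 i2,
    ofReal_integral_eq_lintegral_ofReal hf (Filter.Eventually.of_forall hf0),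
    ofReal_integral_eq_lintegral_ofReal hmin (Filter.Eventually.of_forall hmin0),
    ofReal_integral_eq_lintegral_ofReal hE E0,
    lintegral_eq_lintegral_meas_lt _ (Filter.Eventually.of_forall hf0) hf.aemeasurable,
    lintegral_eq_lintegral_meas_lt _ (Filter.Eventually.of_forall hmin0) hmin.aemeasurable]
  have cut (k : ℝ → ℝ) (hk : ∀ x, k x ≤ 1) :
      ∫⁻ t in Set.Ioi 0, volume {x | t < k x} = ∫⁻ t in Set.Ioo 0 1, volume {x | t < k x} := by
    rw [← Set.Ioo_union_Ici_eq_Ioi zero_lt_one, lintegral_union measurableSet_Ici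
      (Set.disjoint_left.2 fun x hx hx' => absurd hx.2 (not_lt.2 hx'))]
    rw [setLIntegral_congr_fun (g := fun _ => 0) measurableSet_Ici, lintegral_zero, add_zero]
    intro t ht
    have : {x | t < k x} = ∅ := by
      ext x; simpa using (hk x).trans ht
    simp [this]
  rw [cut f hf1, cut _ fun x => (min_le_left _ _).trans (hf1 x),
    setLIntegral_Ioo_zero_one_eq_lintegral_expDecay,
    setLIntegral_Ioo_zero_one_eq_lintegral_expDecay]
  have hanti : Measurable fun u => volume {x | Real.exp (-u) < min (f x) (m x)} := by
    refine Monotone.measurable fun u v huv => measure_mono fun x hx => ?_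
    exact lt_of_le_of_lt (Real.exp_le_exp.2 (neg_le_neg huv)) hx
  rw [← lintegral_add_left hanti]
  refine lintegral_mono_ae (ae_expDecay_pos.mono fun u hu => ?_)
  refine le_trans ?_ (add_le_add le_rfl (h u hu))
  refine (measure_mono ?_).trans (measure_union_le _ _)
  intro x hx
  by_cases hx' : Real.exp (-u) < m x
  · exact Or.inl (lt_min hx hx')
  · exact Or.inr ⟨hx, hx'⟩

/-- Layer cake with the levels of m at or above 1 discarded, hence only an inequality. -/
theorem integrable_and_integral_expDecay_le_of_le_volume {m M : ℝ → ℝ} (hm0 : ∀ x, 0 ≤ m x)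
    (hm : Integrable m) (hM : MonotoneOn M (Set.Ioi 0)) (hM0 : ∀ u, 0 < u → 0 ≤ M u)
    (h : ∀ u, 0 < u → ENNReal.ofReal (M u) ≤ volume {x | Real.exp (-u) < m x}) :
    Integrable M expDecay ∧ ∫ u, M u ∂expDecay ≤ ∫ x, m x := by
  refine integrable_and_integral_le_of_lintegral_le hM.aestronglyMeasurable_expDecay
    (ae_expDecay_pos.mono hM0) (integral_nonneg hm0) ?_
  rw [ofReal_integral_eq_lintegral_ofReal hm (Filter.Eventually.of_forall hm0),
    lintegral_eq_lintegral_meas_lt _ (Filter.Eventually.of_forall hm0) hm.aemeasurable]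
  calc _ ≤ ∫⁻ u, volume {x | Real.exp (-u) < m x} ∂expDecay :=
        lintegral_mono_ae (ae_expDecay_pos.mono h)
    _ = ∫⁻ t in Set.Ioo 0 1, volume {x | t < m x} :=
        (setLIntegral_Ioo_zero_one_eq_lintegral_expDecay fun t => volume {x | t < m x}).symm
    _ ≤ _ := lintegral_mono_set Set.Ioo_subset_Ioi_self

/-! ### Endpoints of superlevel sets -/

/-- All superlevel sets of `f` at levels in `(0, 1)` are non-empty and bounded. -/
def HasBoundedLevels (f : ℝ → ℝ) : Prop :=
  ∀ u, 0 < u → (∃ x, Real.exp (-u) < f x) ∧ ∃ B, ∀ x, Real.exp (-u) < f x → |x| ≤ B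

/-- The supremum of the superlevel set of `f` at level `exp (-u)`. -/
noncomputable def upperEnd (f : ℝ → ℝ) (u : ℝ) : ℝ := sSup {x | Real.exp (-u) < f x}

theorem HasBoundedLevels.comp_neg {f : ℝ → ℝ} (hf : HasBoundedLevels f) :
    HasBoundedLevels fun x => f (-x) := by
  intro u hu
  obtain ⟨⟨x, hx⟩, B, hB⟩ := hf u hu
  exact ⟨⟨-x, by simpa using hx⟩, B, fun y hy => by simpa using hB (-y) hy⟩

theorem HasBoundedLevels.le_upperEnd {f : ℝ → ℝ} (hf : HasBoundedLevels f) {u x : ℝ} (hu : 0 < u)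
    (hx : Real.exp (-u) < f x) : x ≤ upperEnd f u := by
  obtain ⟨B, hB⟩ := (hf u hu).2
  exact le_csSup ⟨B, fun y hy => (le_abs_self y).trans (hB y hy)⟩ hx

theorem HasBoundedLevels.neg_upperEnd_comp_neg_le {f : ℝ → ℝ} (hf : HasBoundedLevels f) {u x : ℝ}
    (hu : 0 < u) (hx : Real.exp (-u) < f x) : -upperEnd (fun x => f (-x)) u ≤ x := by
  have := hf.comp_neg.le_upperEnd hu (x := -x) (by simpa using hx)
  linarith

theorem HasBoundedLevels.monotoneOn_upperEnd {f : ℝ → ℝ} (hf : HasBoundedLevels f) :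
    MonotoneOn (upperEnd f) (Set.Ioi 0) := fun u hu _ hv huv =>
  csSup_le (hf u hu).1 fun _ hx =>
    hf.le_upperEnd hv (lt_of_le_of_lt (Real.exp_le_exp.2 (neg_le_neg huv)) hx)

theorem HasBoundedLevels.upperEnd_add_nonneg {f : ℝ → ℝ} (hf : HasBoundedLevels f) {u v : ℝ}
    (hu : 0 < u) (hv : 0 < v) : 0 ≤ upperEnd f u + upperEnd (fun x => f (-x)) v := by
  obtain ⟨x, hx⟩ := (hf (min u v) (lt_min hu hv)).1
  have h1 := hf.le_upperEnd hu
    (lt_of_le_of_lt (Real.exp_le_exp.2 (neg_le_neg (min_le_left u v))) hx)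
  have h2 := hf.neg_upperEnd_comp_neg_le hv
    (lt_of_le_of_lt (Real.exp_le_exp.2 (neg_le_neg (min_le_right u v))) hx)
  linarith

theorem exp_neg_half_lt_of_mul_le_sq {f g m : ℝ → ℝ} (hm0 : ∀ x, 0 ≤ m x)
    (h : ∀ r s, f r * g s ≤ m ((r + s) / 2) ^ 2) {u v x y : ℝ} (hx : Real.exp (-u) < f x)
    (hy : Real.exp (-v) < g y) : Real.exp (-((u + v) / 2)) < m ((x + y) / 2) := by
  refine lt_of_pow_lt_pow_left₀ 2 (hm0 _) (lt_of_lt_of_le ?_ (h x y))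
  rw [sq, ← Real.exp_add, show -((u + v) / 2) + -((u + v) / 2) = -u + -v by ring, Real.exp_add]
  exact mul_lt_mul'' hx hy (Real.exp_pos _).le (Real.exp_pos _).le

/-- Midpoints of points in the two superlevel sets lie in that of m at the geometric mean of the
levels; take suprema one variable at a time. The superlevel sets of f and g need not be intervals.
-/
theorem upperEnd_add_upperEnd_le {f g m : ℝ → ℝ} (hf : HasBoundedLevels f)
    (hg : HasBoundedLevels g) (hm : HasBoundedLevels m) (hm0 : ∀ x, 0 ≤ m x)
    (h : ∀ r s, f r * g s ≤ m ((r + s) / 2) ^ 2) (u v : ℝ) (hu : 0 < u) (hv : 0 < v) :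
    upperEnd f u + upperEnd g v ≤ 2 * upperEnd m ((u + v) / 2) := by
  rw [← le_sub_iff_add_le]
  refine csSup_le (hf u hu).1 fun x hx => ?_
  rw [le_sub_comm]
  refine csSup_le (hg v hv).1 fun y hy => ?_
  have := hm.le_upperEnd (by positivity) (exp_neg_half_lt_of_mul_le_sq hm0 h hx hy)
  linarith

theorem HasBoundedLevels.Ioo_subset {m : ℝ → ℝ} (hm : HasBoundedLevels m)
    (hc : ∀ t, Set.OrdConnected {x | t < m x}) {u : ℝ} (hu : 0 < u) :
    Set.Ioo (-upperEnd (fun x => m (-x)) u) (upperEnd m u) ⊆ {x | Real.exp (-u) < m x} := by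
  rintro x ⟨h1, h2⟩
  obtain ⟨y, hy, hxy⟩ := exists_lt_of_lt_csSup (hm u hu).1 h2
  obtain ⟨z, hz, hxz⟩ := exists_lt_of_lt_csSup (hm.comp_neg u hu).1 (neg_lt.1 h1)
  exact (hc _).out hz hy ⟨by linarith, hxy.le⟩

/-- The set for f lies between its extreme endpoints and the set for m contains an open interval, so
the difference can only stick out at the two ends. -/
theorem volume_sdiff_superlevel_le {f m : ℝ → ℝ} (hf : HasBoundedLevels f)
    (hm : HasBoundedLevels m) (hc : ∀ t, Set.OrdConnected {x | t < m x}) {u : ℝ} (hu : 0 < u)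
    (b : ℝ) :
    volume ({x | Real.exp (-u) < f x} \ {x | Real.exp (-u) < m (x + b)}) ≤
      ENNReal.ofReal (upperEnd f u - (upperEnd m u - b)) +
      ENNReal.ofReal (upperEnd (fun x => f (-x)) u - (upperEnd (fun x => m (-x)) u + b)) := by
  have hsub : {x | Real.exp (-u) < f x} \ {x | Real.exp (-u) < m (x + b)} ⊆
      Set.Icc (upperEnd m u - b) (upperEnd f u) ∪
        Set.Icc (-upperEnd (fun x => f (-x)) u) (-(upperEnd (fun x => m (-x)) u + b)) := by
    rintro x ⟨hx, hx'⟩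
    by_cases h1 : upperEnd m u - b ≤ x
    · exact Or.inl ⟨h1, hf.le_upperEnd hu hx⟩
    · refine Or.inr ⟨hf.neg_upperEnd_comp_neg_le hu hx, ?_⟩
      by_contra h2
      exact hx' (hm.Ioo_subset hc hu ⟨by linarith, by linarith⟩)
  refine (measure_mono hsub).trans ((measure_union_le _ _).trans (le_of_eq ?_))
  rw [Real.volume_Icc, Real.volume_Icc]
  congr 2
  ring

/-! ### Stability for functions with supremum one -/

/-- I is squeezed between the arithmetic mean and almost the geometric mean, so (√x - √y)² ≤ 2εI,
which forces y to be within order √ε of I. -/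
theorem sub_le_three_mul_sqrt_mul {x y I ε : ℝ} (hx : 0 ≤ x) (hy : 0 ≤ y) (h0 : 0 ≤ ε)
    (h1 : ε ≤ 1) (hI : (x + y) / 2 ≤ I) (hI' : I ≤ (1 + ε) * √(x * y)) :
    I - y ≤ 3 * (√ε * I) := by
  have hX := Real.sqrt_nonneg x
  have hY := Real.sqrt_nonneg y
  have hE := Real.sqrt_nonneg ε
  have hX2 := Real.sq_sqrt hx
  have hY2 := Real.sq_sqrt hy
  have hE2 := Real.sq_sqrt h0
  rw [Real.sqrt_mul hx] at hI'
  set X := √x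
  set Y := √y
  set e := √ε
  have e1 : e ≤ 1 := Real.sqrt_le_one.2 h1
  have hXY : X * Y ≤ I := by nlinarith [sq_nonneg (X - Y)]
  have hI0 : 0 ≤ I := (mul_nonneg hX hY).trans hXY
  have hd : (X - Y) ^ 2 ≤ 2 * ε * I := by nlinarith
  have hYI : Y ^ 2 ≤ 2 * I := by nlinarith
  have key : Y * (X - Y) ≤ 2 * (e * I) := by
    refine le_of_sq_le_sq ?_ (by positivity)
    have := mul_le_mul hYI hd (sq_nonneg _) (by positivity)
    calc (Y * (X - Y)) ^ 2 = Y ^ 2 * (X - Y) ^ 2 := by ring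
      _ ≤ 2 * I * (2 * ε * I) := this
      _ = (2 * (e * I)) ^ 2 := by rw [← hE2]; ring
  have : ε * (X * Y) ≤ e * I := by
    rw [← hE2]
    have : e ^ 2 ≤ e := by nlinarith
    exact mul_le_mul this hXY (by positivity) hE
  nlinarith

theorem integral_abs_sub_le_of_integral_le {f m : ℝ → ℝ} {c : ℝ} (hf : Integrable f)
    (hm : Integrable m) (h : ∫ x, f x ≤ (∫ x, min (f x) (m x)) + c) :
    ∫ x, |f x - m x| ≤ 2 * c + ((∫ x, m x) - ∫ x, f x) := by
  have hmin : Integrable fun x => min (f x) (m x) := hf.inf hm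
  have e : ∀ x, |f x - m x| = f x + m x - 2 * min (f x) (m x) := fun x => by
    rcases le_total (f x) (m x) with h | h
    · rw [min_eq_left h, abs_of_nonpos (by linarith)]; ring
    · rw [min_eq_right h, abs_of_nonneg (by linarith)]; ring
  have hfm : Integrable fun x => f x + m x := hf.add hm
  simp only [e]
  rw [integral_sub hfm (hmin.const_mul 2), integral_add hf hm, integral_const_mul]
  linarith

/-- The midpoint Prékopa–Leindler inequality in additive form for functions with supremum one,
where the mean is dominated by a quasi-concave function, and its stability. -/
theorem half_add_le_integral_and_stability {m f g : ℝ → ℝ} (hm0 : ∀ x, 0 ≤ m x)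
    (hf0 : ∀ x, 0 ≤ f x) (hg0 : ∀ x, 0 ≤ g x) (hmi : Integrable m) (hfi : Integrable f)
    (hgi : Integrable g) (hf1 : ∀ x, f x ≤ 1) (hg1 : ∀ x, g x ≤ 1) (hf : HasBoundedLevels f)
    (hg : HasBoundedLevels g) (hm : HasBoundedLevels m)
    (hc : ∀ t, Set.OrdConnected {x | t < m x}) (h : ∀ r s, f r * g s ≤ m ((r + s) / 2) ^ 2) :
    ((∫ x, f x) + ∫ x, g x) / 2 ≤ ∫ x, m x ∧
    ∀ ε, 0 < ε → ε ≤ 1 / 4 → ∫ x, m x ≤ (1 + ε) * √((∫ x, f x) * ∫ x, g x) →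
      ∃ b, ∫ x, |f x - m (x + b)| ≤ 1200 * √ε * ∫ x, m x ∧
        ∫ x, |g x - m (x - b)| ≤ 1200 * √ε * ∫ x, m x := by
  have h' : ∀ r s, f (-r) * g (-s) ≤ m (-((r + s) / 2)) ^ 2 := fun r s => by
    have := h (-r) (-s)
    rwa [show (-r + -s) / 2 = -((r + s) / 2) by ring] at this
  set P := upperEnd f with hP
  set P' := upperEnd fun x => f (-x) with hP'
  set Q := upperEnd g with hQ
  set Q' := upperEnd fun x => g (-x) with hQ'
  set R := upperEnd m with hR
  set R' := upperEnd fun x => m (-x) with hR'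
  have mP : MonotoneOn P (Set.Ioi 0) := hf.monotoneOn_upperEnd
  have mQ : MonotoneOn Q (Set.Ioi 0) := hg.monotoneOn_upperEnd
  have mR : MonotoneOn R (Set.Ioi 0) := hm.monotoneOn_upperEnd
  have mP' : MonotoneOn P' (Set.Ioi 0) := hf.comp_neg.monotoneOn_upperEnd
  have mQ' : MonotoneOn Q' (Set.Ioi 0) := hg.comp_neg.monotoneOn_upperEnd
  have mR' : MonotoneOn R' (Set.Ioi 0) := hm.comp_neg.monotoneOn_upperEnd
  have hadd : ∀ u v, 0 < u → 0 < v → P u + Q v ≤ 2 * R ((u + v) / 2) :=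
    upperEnd_add_upperEnd_le hf hg hm hm0 h
  have hadd' : ∀ u v, 0 < u → 0 < v → P' u + Q' v ≤ 2 * R' ((u + v) / 2) :=
    upperEnd_add_upperEnd_le hf.comp_neg hg.comp_neg hm.comp_neg (fun x => hm0 (-x)) h'
  have hF0 : ∀ u v, 0 < u → 0 < v → 0 ≤ P u + P' v := fun u v hu hv => hf.upperEnd_add_nonneg hu hv
  have hG0 : ∀ u v, 0 < u → 0 < v → 0 ≤ Q u + Q' v := fun u v hu hv => hg.upperEnd_add_nonneg hu hv
  have hM0 : ∀ u v, 0 < u → 0 < v → 0 ≤ R u + R' v := fun u v hu hv => hm.upperEnd_add_nonneg hu hv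
  have hd (u : ℝ) (hu : 0 < u) : 0 ≤ R u - (P u + Q u) / 2 := by
    have := hadd u u hu hu
    rw [show (u + u) / 2 = u by ring] at this
    linarith
  have hd' (u : ℝ) (hu : 0 < u) : 0 ≤ R' u - (P' u + Q' u) / 2 := by
    have := hadd' u u hu hu
    rw [show (u + u) / 2 = u by ring] at this
    linarith
  have hMvol (u : ℝ) (hu : 0 < u) :
      ENNReal.ofReal (R u + R' u) ≤ volume {x | Real.exp (-u) < m x} := by
    have := measure_mono (μ := volume) (hm.Ioo_subset hc hu)
    rw [Real.volume_Ioo, sub_neg_eq_add] at this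
    exact this
  obtain ⟨iM, hMle⟩ := integrable_and_integral_expDecay_le_of_le_volume hm0 hmi (mR.add mR')
    (fun u hu => hM0 u u hu hu) hMvol
  -- Domination by 2 (R + R'), since Q + Q' ≥ 0.
  have iF : Integrable (fun u => P u + P' u) expDecay := by
    refine (iM.const_mul 2).mono' (mP.add mP').aestronglyMeasurable_expDecay
      (ae_expDecay_pos.mono fun u hu => ?_)
    have := hd u hu; have := hd' u hu; have := hF0 u u hu hu; have := hG0 u u hu hu
    rw [Real.norm_of_nonneg (hF0 u u hu hu)]
    linarith
  have iG : Integrable (fun u => Q u + Q' u) expDecay := by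
    refine (iM.const_mul 2).mono' (mQ.add mQ').aestronglyMeasurable_expDecay
      (ae_expDecay_pos.mono fun u hu => ?_)
    have := hd u hu; have := hd' u hu; have := hF0 u u hu hu; have := hG0 u u hu hu
    rw [Real.norm_of_nonneg (hG0 u u hu hu)]
    linarith
  have layer {k K K' : ℝ → ℝ} (hk0 : ∀ x, 0 ≤ k x) (hk1 : ∀ x, k x ≤ 1) (hki : Integrable k)
      (hk : HasBoundedLevels k) (hK : K = upperEnd k) (hK' : K' = upperEnd fun x => k (-x))
      (hi : Integrable (fun u => K u + K' u) expDecay) :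
      ∫ x, k x ≤ ∫ u, (K u + K' u) ∂expDecay := by
    subst hK hK'
    -- With the zero function for m, the set difference is the whole superlevel set.
    have := integral_le_integral_min_add_of_volume_sdiff_le hk0 hk1 hki (m := fun _ => 0)
      (fun _ => le_rfl) (integrable_zero _ _ _) hi
      (fun u hu => hk.upperEnd_add_nonneg hu hu) (fun u hu => by
        refine (measure_mono (t := Set.Icc _ _) fun x hx =>
          ⟨hk.neg_upperEnd_comp_neg_le hu hx.1, hk.le_upperEnd hu hx.1⟩).trans (le_of_eq ?_)
        rw [Real.volume_Icc, sub_neg_eq_add])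
    simpa [min_eq_right (hk0 _)] using this
  have hfF := layer hf0 hf1 hfi hf hP hP' iF
  have hgG := layer hg0 hg1 hgi hg hQ hQ' iG
  have hMsplit : ∫ u, (R u + R' u) ∂expDecay = ∫ u, (R u + R' u - (P u + P' u + (Q u + Q' u)) / 2)
      ∂expDecay + (∫ u, (P u + P' u) ∂expDecay + ∫ u, (Q u + Q' u) ∂expDecay) / 2 := by
    have e : ∫ u, (R u + R' u - (P u + P' u + (Q u + Q' u)) / 2) ∂expDecay =
        ∫ u, (R u + R' u) ∂expDecay - ∫ u, (P u + P' u + (Q u + Q' u)) / 2 ∂expDecay :=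
      integral_sub iM ((iF.add iG).div_const 2)
    rw [e, integral_div, integral_add iF iG]
    ring
  set I := ∫ x, m x with hIdef
  set x := ∫ x, f x with hxdef
  set y := ∫ x, g x with hydef
  have iΔ : Integrable (fun u => R u + R' u - (P u + P' u + (Q u + Q' u)) / 2) expDecay :=
    iM.sub ((iF.add iG).div_const 2)
  have Δ0 : 0 ≤ ∫ u, (R u + R' u - (P u + P' u + (Q u + Q' u)) / 2) ∂expDecay :=
    integral_nonneg_of_ae (ae_expDecay_pos.mono fun u hu => by
      have := hd u hu; have := hd' u hu
      simp only [Pi.zero_apply]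
      linarith)
  have hAG : (x + y) / 2 ≤ I := by linarith
  refine ⟨hAG, fun ε ε0 ε1 hI => ?_⟩
  have hx0 : 0 ≤ x := integral_nonneg hf0
  have hy0 : 0 ≤ y := integral_nonneg hg0
  have hI0 : 0 ≤ I := integral_nonneg hm0
  have hIx : I - x ≤ 3 * (√ε * I) := by
    refine sub_le_three_mul_sqrt_mul hy0 hx0 ε0.le (by linarith) (by linarith) ?_
    rwa [mul_comm y x]
  have hIy : I - y ≤ 3 * (√ε * I) :=
    sub_le_three_mul_sqrt_mul hx0 hy0 ε0.le (by linarith) hAG hI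
  have hs : √(x * y) ≤ (x + y) / 2 := by
    rw [Real.sqrt_le_left (by positivity)]
    nlinarith [sq_nonneg (x - y)]
  have hη : ∫ u, (R u + R' u - (P u + P' u + (Q u + Q' u)) / 2) ∂expDecay ≤ ε * I := by
    have : ε * √(x * y) ≤ ε * I := mul_le_mul_of_nonneg_left (hs.trans hAG) ε0.le
    linarith
  have e3 : Real.exp 3 ≤ 21 := by
    have := Real.exp_one_lt_d9
    have h3 : Real.exp 3 = Real.exp 1 ^ 3 := by rw [← Real.exp_nat_mul]; norm_num
    rw [h3]
    calc Real.exp 1 ^ 3 ≤ 2.7182818286 ^ 3 := by gcongr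
      _ ≤ 21 := by norm_num
  -- Markov's inequality at level exp (-3).
  have hM3 : R 3 + R' 3 ≤ 21 * I := by
    have hv : R 3 + R' 3 ≤ volume.real {x | Real.exp (-3) ≤ m x} := by
      have h1 := (hMvol 3 (by norm_num)).trans
        (measure_mono (t := {x | Real.exp (-3) ≤ m x}) fun x hx =>
          (show Real.exp (-3) < m x from hx).le)
      refine (ENNReal.ofReal_le_iff_le_toReal ?_).1 h1
      exact (hmi.measure_ge_lt_top (Real.exp_pos _)).ne
    have hmk := mul_meas_ge_le_integral_of_nonneg (Filter.Eventually.of_forall hm0) hmi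
      (Real.exp (-3))
    have hmul : Real.exp 3 * (Real.exp (-3) * volume.real {x | Real.exp (-3) ≤ m x}) ≤
        Real.exp 3 * I := mul_le_mul_of_nonneg_left hmk (Real.exp_pos _).le
    rw [← mul_assoc, ← Real.exp_add] at hmul
    norm_num at hmul
    nlinarith
  have hA : (P 3 + P' 3) + (Q 3 + Q' 3) ≤ 42 * I := by
    have := hd 3 (by norm_num); have := hd' 3 (by norm_num)
    linarith
  set s := √ε with hsdef
  have s0 : 0 < s := Real.sqrt_pos.2 ε0
  have s1 : s ≤ 1 / 2 := by
    rw [hsdef, Real.sqrt_le_left (by norm_num)]; linarith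
  have ss : s ^ 2 = ε := Real.sq_sqrt ε0.le
  have hds : ε * I / s = s * I := by
    rw [← ss]; field_simp
  -- Stated abstractly to serve both the right and the left endpoints. With h = s and A = 42 I, the
  -- constant is 6 · 42 + 40 = 292.
  have core {p q r p' q' r' : ℝ → ℝ} (hp : MonotoneOn p (Set.Ioi 0)) (hq : MonotoneOn q (Set.Ioi 0))
      (hr : MonotoneOn r (Set.Ioi 0))
      (hpq : ∀ u v, 0 < u → 0 < v → p u + q v ≤ 2 * r ((u + v) / 2))
      (hpp : ∀ u v, 0 < u → 0 < v → 0 ≤ p u + p' v) (hqq : ∀ u v, 0 < u → 0 < v → 0 ≤ q u + q' v)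
      (hA : p 3 + p' 3 + (q 3 + q' 3) ≤ 42 * I)
      (hd' : ∀ u, 0 < u → 0 ≤ r' u - (p' u + q' u) / 2)
      (hi : Integrable (fun u => r u + r' u - (p u + p' u + (q u + q' u)) / 2) expDecay)
      (hη : ∫ u, (r u + r' u - (p u + p' u + (q u + q' u)) / 2) ∂expDecay ≤ ε * I) :
      ∃ κ, Integrable (fun u => |p u - q u - κ|) expDecay ∧
        ∫ u, |p u - q u - κ| ∂expDecay ≤ 292 * (s * I) := by
    have hd (u : ℝ) (hu : 0 < u) : 0 ≤ r u - (p u + q u) / 2 := by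
      have := hpq u u hu hu
      rw [show (u + u) / 2 = u by ring] at this
      linarith
    obtain ⟨κ, hκ⟩ := exists_lintegral_exp_neg_mul_abs_sub_le hp hq hr hpq
      -- The left endpoints at parameter 3 bound the right endpoints from below, uniformly in u.
      (S0 := -(p' 3 + q' 3)) (A := 42 * I) (η := ε * I) (h := s)
      (fun u hu => by linarith [hpp u 3 hu (by norm_num), hqq u 3 hu (by norm_num)])
      (by linarith) s0 s1 (by positivity) (by
        rw [← lintegral_expDecay fun u => ENNReal.ofReal (r u - (p u + q u) / 2)]
        refine le_trans ?_ (ENNReal.ofReal_le_ofReal hη)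
        rw [ofReal_integral_eq_lintegral_ofReal hi (ae_expDecay_pos.mono fun u hu => by
          have := hd u hu; have := hd' u hu
          simp only [Pi.zero_apply]
          linarith)]
        refine lintegral_mono_ae (ae_expDecay_pos.mono fun u hu => ENNReal.ofReal_le_ofReal ?_)
        linarith [hd' u hu])
    refine ⟨κ, integrable_and_integral_le_of_lintegral_le ?_
      (Filter.Eventually.of_forall fun _ => abs_nonneg _) (by positivity) ?_⟩
    · exact ((hp.aestronglyMeasurable_expDecay.sub hq.aestronglyMeasurable_expDecay).sub
        aestronglyMeasurable_const).norm
    · rw [lintegral_expDecay]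
      simp only [← ENNReal.ofReal_mul (Real.exp_pos _).le]
      refine hκ.trans (ENNReal.ofReal_le_ofReal (le_of_eq ?_))
      rw [hds]; ring
  obtain ⟨κ, iD, hD⟩ := core (p' := P') (q' := Q') (r' := R') mP mQ mR hadd hF0 hG0 hA hd' iΔ hη
  obtain ⟨κ', iD', hD'⟩ := core (p' := P) (q' := Q) (r' := R) mP' mQ' mR' hadd'
    (fun u v hu hv => by rw [add_comm]; exact hF0 v u hv hu)
    (fun u v hu hv => by rw [add_comm]; exact hG0 v u hv hu) (by linarith) hd
    (by simpa only [add_comm (P' _), add_comm (Q' _), add_comm (R' _)] using iΔ)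
    (by simpa only [add_comm (P' _), add_comm (Q' _), add_comm (R' _)] using hη)
  have hFG {F G : ℝ → ℝ} {c z : ℝ} (iF : Integrable F expDecay) (iG : Integrable G expDecay)
      (hle : ∀ u, c ≤ F u - G u + (|P u - Q u - κ| + |P' u - Q' u - κ'|))
      (hFG : ∫ u, F u ∂expDecay + ∫ u, G u ∂expDecay ≤ 2 * I) (hz : z ≤ ∫ u, G u ∂expDecay)
      (hIz : I - z ≤ 3 * (s * I)) : c ≤ 590 * (s * I) := by
    have := integral_mono (μ := expDecay) (integrable_const c) ((iF.sub iG).add (iD.add iD')) hle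
    have e : ∫ u, (F u - G u + (|P u - Q u - κ| + |P' u - Q' u - κ'|)) ∂expDecay =
        ∫ u, F u ∂expDecay - ∫ u, G u ∂expDecay +
          (∫ u, |P u - Q u - κ| ∂expDecay + ∫ u, |P' u - Q' u - κ'| ∂expDecay) := by
      rw [← integral_sub iF iG, ← integral_add iD iD']
      exact integral_add (iF.sub iG) (iD.add iD')
    have this : ∫ _, c ∂expDecay ≤ _ := this.trans (le_of_eq e)
    rw [integral_const] at this
    simp only [probReal_univ, one_smul] at this
    linarith
  -- κ + κ' is close to the integral of (P + P') - (Q + Q'), which is at most 6sI in absolute value;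
  -- 590 = 6 + 2 · 292.
  have hκ : |κ + κ'| ≤ 590 * (s * I) := by
    rw [abs_le']
    refine ⟨hFG iF iG (fun u => ?_) (by linarith) hgG hIy,
      hFG iG iF (fun u => ?_) (by linarith) hfF hIx⟩
    · linarith [neg_abs_le (P u - Q u - κ), neg_abs_le (P' u - Q' u - κ'),
        le_abs_self (P u - Q u - κ), le_abs_self (P' u - Q' u - κ')]
    · linarith [neg_abs_le (P u - Q u - κ), neg_abs_le (P' u - Q' u - κ'),
        le_abs_self (P u - Q u - κ), le_abs_self (P' u - Q' u - κ')]
  set E : ℝ → ℝ := fun u => (|P u - Q u - κ| + |P' u - Q' u - κ'| + |κ + κ'|) / 2 with hE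
  have iE : Integrable E expDecay := ((iD.add iD').add (integrable_const _)).div_const 2
  have hEle : ∫ u, E u ∂expDecay ≤ 587 * (s * I) := by
    have e : ∫ u, E u ∂expDecay = (∫ u, |P u - Q u - κ| ∂expDecay +
        ∫ u, |P' u - Q' u - κ'| ∂expDecay + |κ + κ'|) / 2 := by
      have e1 : ∫ u, (|P u - Q u - κ| + |P' u - Q' u - κ'| + |κ + κ'|) ∂expDecay = _ :=
        integral_add (iD.add iD') (integrable_const _)
      have e2 : ∫ u, (|P u - Q u - κ| + |P' u - Q' u - κ'|) ∂expDecay = _ := integral_add iD iD'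
      rw [hE, integral_div, e1]
      rw [e2]
      simp
    rw [e]; linarith
  have finish {k : ℝ → ℝ} {b : ℝ} (hk0 : ∀ x, 0 ≤ k x) (hk1 : ∀ x, k x ≤ 1) (hki : Integrable k)
      (hIk : I - ∫ x, k x ≤ 3 * (s * I)) (hk : HasBoundedLevels k)
      (hE1 : ∀ u, 0 < u → max (upperEnd k u - (R u - b)) 0 +
        max (upperEnd (fun x => k (-x)) u - (R' u + b)) 0 ≤ E u) :
      ∫ x, |k x - m (x + b)| ≤ 1200 * s * I := by
    have hle := integral_le_integral_min_add_of_volume_sdiff_le hk0 hk1 hki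
      (m := fun x => m (x + b)) (fun x => hm0 _) (hmi.comp_add_right b) iE
      (fun u hu => by positivity) (fun u hu => by
        refine (volume_sdiff_superlevel_le hk hm hc hu b).trans ?_
        refine (add_le_add (ENNReal.ofReal_le_ofReal (le_max_left _ 0))
          (ENNReal.ofReal_le_ofReal (le_max_left _ 0))).trans ?_
        rw [← ENNReal.ofReal_add (le_max_right _ _) (le_max_right _ _)]
        exact ENNReal.ofReal_le_ofReal (hE1 u hu))
    have := integral_abs_sub_le_of_integral_le hki (hmi.comp_add_right b) hle
    rw [integral_add_right_eq_self (fun x => m x) b] at this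
    nlinarith [mul_nonneg s0.le hI0]
  -- As R ≥ (P + Q) / 2, this shift leaves P an excess of at most (P - Q - κ) / 2. On the left the
  -- same shift plays the role of κ' / 2, at the cost of |κ + κ'| / 2.
  refine ⟨-κ / 2, finish hf0 hf1 hfi hIx hf fun u hu => ?_, ?_⟩
  · have h1 := hd u hu
    have h2 := hd' u hu
    have : max (P u - (R u - -κ / 2)) 0 ≤ |P u - Q u - κ| / 2 :=
      max_le (by linarith [le_abs_self (P u - Q u - κ)]) (by positivity)
    have : max (P' u - (R' u + -κ / 2)) 0 ≤ (|P' u - Q' u - κ'| + |κ + κ'|) / 2 :=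
      max_le (by linarith [le_abs_self (P' u - Q' u - κ'), le_abs_self (κ + κ')]) (by positivity)
    simp only [hE]; linarith
  · have := finish (b := κ / 2) hg0 hg1 hgi hIy hg fun u hu => by
      have h1 := hd u hu
      have h2 := hd' u hu
      have : max (Q u - (R u - κ / 2)) 0 ≤ |P u - Q u - κ| / 2 :=
        max_le (by linarith [neg_abs_le (P u - Q u - κ)]) (by positivity)
      have : max (Q' u - (R' u + κ / 2)) 0 ≤ (|P' u - Q' u - κ'| + |κ + κ'|) / 2 :=
        max_le (by linarith [neg_abs_le (P' u - Q' u - κ'), neg_abs_le (κ + κ')]) (by positivity)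
      simp only [hE]; linarith
    have e : ∀ x, x - -κ / 2 = x + κ / 2 := fun x => by ring
    simpa only [e] using this

/-! ### Log-concave functions and boundedness of superlevel sets -/

theorem LogConcaveFun.min_le {m : ℝ → ℝ} (hm : LogConcaveFun m) {x y z : ℝ} (hxz : x ≤ z)
    (hzy : z ≤ y) : min (m x) (m y) ≤ m z := by
  rcases hxz.eq_or_lt with rfl | hxz
  · exact min_le_left _ _
  rcases hzy.eq_or_lt with rfl | hzy
  · exact min_le_right _ _
  have hxy : 0 < y - x := by linarith
  set l := (z - x) / (y - x) with hl
  have l0 : 0 < l := div_pos (by linarith) hxy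
  have l1 : l < 1 := (div_lt_one hxy).2 (by linarith)
  have hz : (1 - l) * x + l * y = z := by
    rw [hl]; field_simp; ring
  rw [← hz]
  refine le_trans ?_ (hm.2 x y l l0 l1)
  have h0 : 0 ≤ min (m x) (m y) := le_min (hm.1 x) (hm.1 y)
  calc min (m x) (m y) = min (m x) (m y) ^ (1 - l) * min (m x) (m y) ^ l := by
        rw [← Real.rpow_add' h0 (by simp), sub_add_cancel, Real.rpow_one]
    _ ≤ m x ^ (1 - l) * m y ^ l :=
        mul_le_mul (Real.rpow_le_rpow h0 (min_le_left _ _) (by linarith))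
          (Real.rpow_le_rpow h0 (min_le_right _ _) l0.le) (Real.rpow_nonneg h0 _)
          (Real.rpow_nonneg (hm.1 x) _)

theorem LogConcaveFun.ordConnected {m : ℝ → ℝ} (hm : LogConcaveFun m) (t : ℝ) :
    Set.OrdConnected {x | t < m x} :=
  ⟨fun _ hx _ hy _ hz => (lt_min hx hy).trans_le (hm.min_le hz.1 hz.2)⟩

theorem LogConcaveFun.sqrt_mul_le {m : ℝ → ℝ} (hm : LogConcaveFun m) (x y : ℝ) :
    √(m x * m y) ≤ m ((x + y) / 2) := by
  have := hm.2 x y (1 / 2) (by norm_num) (by norm_num)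
  rw [show (1 : ℝ) - 1 / 2 = 1 / 2 by norm_num, ← Real.sqrt_eq_rpow, ← Real.sqrt_eq_rpow,
    ← Real.sqrt_mul (hm.1 x)] at this
  rwa [show (x + y) / 2 = 1 / 2 * x + 1 / 2 * y by ring]

/-- If m ≥ t > 0 on [a, b], then m ≥ √(m x · t) on the midpoints of x with [a, b], an interval of
length (b - a) / 2 whatever x is; Markov's inequality then bounds m x. -/
theorem LogConcaveFun.exists_le {m : ℝ → ℝ} (hm : LogConcaveFun m) (hi : Integrable m)
    (hpos : 0 < ∫ x, m x) : ∃ B, ∀ x, m x ≤ B := by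
  obtain ⟨a, b, hab, ha, hb⟩ : ∃ a b, a < b ∧ 0 < m a ∧ 0 < m b := by
    by_contra! hcon
    have hsub : (Function.support m).Subsingleton := by
      intro x hx y hy
      have hx0 := lt_of_le_of_ne (hm.1 x) (Ne.symm hx)
      have hy0 := lt_of_le_of_ne (hm.1 y) (Ne.symm hy)
      rcases lt_trichotomy x y with h | h | h
      · exact absurd hy0 (not_lt.2 (hcon x y h hx0))
      · exact h
      · exact absurd hx0 (not_lt.2 (hcon y x h hy0))
    have := (integral_pos_iff_support_of_nonneg hm.1 hi).1 hpos
    exact this.ne' (hsub.measure_zero _)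
  set t := min (m a) (m b) with ht
  have t0 : 0 < t := lt_min ha hb
  refine ⟨(2 * (∫ x, m x) / (b - a)) ^ 2 / t, fun x => ?_⟩
  have hsub : Set.Icc ((x + a) / 2) ((x + b) / 2) ⊆ {y | √(m x * t) ≤ m y} := by
    intro y hy
    have h1 : t ≤ m (2 * y - x) := hm.min_le (by linarith [hy.1]) (by linarith [hy.2])
    have h2 := hm.sqrt_mul_le x (2 * y - x)
    rw [show (x + (2 * y - x)) / 2 = y by ring] at h2
    exact (Real.sqrt_le_sqrt (mul_le_mul_of_nonneg_left h1 (hm.1 x))).trans h2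
  rcases (hm.1 x).eq_or_lt with hx | hx
  · rw [← hx]; positivity
  have s0 : 0 < √(m x * t) := Real.sqrt_pos.2 (mul_pos hx t0)
  have hvol : (b - a) / 2 ≤ volume.real {y | √(m x * t) ≤ m y} := by
    have := ENNReal.toReal_mono (hi.measure_ge_lt_top s0).ne (measure_mono (μ := volume) hsub)
    rw [Real.volume_Icc, ENNReal.toReal_ofReal (by linarith)] at this
    have e : (x + b) / 2 - (x + a) / 2 = (b - a) / 2 := by ring
    rwa [e] at this
  have hmk := mul_meas_ge_le_integral_of_nonneg (Filter.Eventually.of_forall hm.1) hi √(m x * t)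
  have hd : 0 < b - a := sub_pos.2 hab
  have h3 : √(m x * t) ≤ 2 * (∫ x, m x) / (b - a) := by
    rw [le_div_iff₀ hd]
    nlinarith
  rw [le_div_iff₀ t0]
  calc m x * t = √(m x * t) ^ 2 := (Real.sq_sqrt (by positivity)).symm
    _ ≤ _ := by gcongr

theorem Set.OrdConnected.exists_abs_le {s : Set ℝ} (hs : s.OrdConnected) (hv : volume s ≠ ⊤) :
    ∃ B, ∀ x ∈ s, |x| ≤ B := by
  rcases s.eq_empty_or_nonempty with rfl | ⟨y, hy⟩
  · exact ⟨0, by simp⟩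
  refine ⟨|y| + (volume s).toReal, fun x hx => ?_⟩
  have := ENNReal.toReal_mono hv (measure_mono (μ := volume) (hs.uIcc_subset hy hx))
  rw [Real.volume_interval, ENNReal.toReal_ofReal (abs_nonneg _)] at this
  have h2 := abs_add_le y (x - y)
  rw [add_sub_cancel] at h2
  linarith

/-- The superlevel sets of m are intervals of finite length. Averaging with one fixed point of the
set for g sends the set for f into such an interval, and conversely. -/
theorem HasBoundedLevels.of_mul_le_sq {f g m : ℝ → ℝ} (hm0 : ∀ x, 0 ≤ m x) (hmi : Integrable m)
    (hc : ∀ t, Set.OrdConnected {x | t < m x}) (h : ∀ r s, f r * g s ≤ m ((r + s) / 2) ^ 2)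
    (hf : ∀ t < 1, ∃ x, t < f x) (hg : ∀ t < 1, ∃ x, t < g x) :
    HasBoundedLevels f ∧ HasBoundedLevels g ∧ HasBoundedLevels m := by
  have key (u : ℝ) (hu : 0 < u) : (∃ x, Real.exp (-u) < f x) ∧ (∃ x, Real.exp (-u) < g x) ∧
      ∃ B, ∀ x, Real.exp (-u) < m x → |x| ≤ B := by
    have h1 : Real.exp (-u) < 1 := by simpa using hu
    exact ⟨hf _ h1, hg _ h1,
      (hc _).exists_abs_le (hmi.measure_gt_lt_top (Real.exp_pos (-u))).ne⟩
  have mid {u x y : ℝ} (hx : Real.exp (-u) < f x) (hy : Real.exp (-u) < g y) :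
      Real.exp (-u) < m ((x + y) / 2) := by
    have := exp_neg_half_lt_of_mul_le_sq hm0 h hx hy
    rwa [show (u + u) / 2 = u by ring] at this
  refine ⟨fun u hu => ?_, fun u hu => ?_, fun u hu => ?_⟩ <;>
    obtain ⟨⟨x, hx⟩, ⟨y, hy⟩, B, hB⟩ := key u hu
  · refine ⟨⟨x, hx⟩, 2 * B + |y|, fun z hz => ?_⟩
    have h1 := hB _ (mid hz hy)
    have h2 := abs_sub (z + y) y
    rw [add_sub_cancel_right] at h2
    rw [abs_div, abs_two, div_le_iff₀ two_pos] at h1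
    linarith
  · refine ⟨⟨y, hy⟩, 2 * B + |x|, fun z hz => ?_⟩
    have h1 := hB _ (mid hx hz)
    have h2 := abs_sub (x + z) x
    rw [add_sub_cancel_left] at h2
    rw [abs_div, abs_two, div_le_iff₀ two_pos] at h1
    linarith
  · exact ⟨⟨_, mid hx hy⟩, B, hB⟩

/-! ### All values of ε, and normalisation of the suprema -/

theorem integral_abs_sub_le_integral_add {f m : ℝ → ℝ} (hf0 : ∀ x, 0 ≤ f x) (hm0 : ∀ x, 0 ≤ m x)
    (hf : Integrable f) (hm : Integrable m) :
    ∫ x, |f x - m x| ≤ (∫ x, f x) + ∫ x, m x := by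
  rw [← integral_add hf hm]
  refine integral_mono (hf.sub hm).abs (hf.add hm) fun x => ?_
  have h1 := hf0 x
  have h2 := hm0 x
  exact abs_le.2 ⟨by linarith, by linarith⟩

theorem exists_integral_abs_sub_le_of_sup_eq_one {m f g : ℝ → ℝ} (hm0 : ∀ x, 0 ≤ m x)
    (hf0 : ∀ x, 0 ≤ f x) (hg0 : ∀ x, 0 ≤ g x) (hmi : Integrable m) (hfi : Integrable f)
    (hgi : Integrable g) (hf1 : ∀ x, f x ≤ 1) (hg1 : ∀ x, g x ≤ 1) (hf : ∀ t < 1, ∃ x, t < f x)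
    (hg : ∀ t < 1, ∃ x, t < g x) (hc : ∀ t, Set.OrdConnected {x | t < m x})
    (h : ∀ r s, f r * g s ≤ m ((r + s) / 2) ^ 2) {ε : ℝ} (ε0 : 0 < ε)
    (hI : ∫ x, m x ≤ (1 + ε) * √((∫ x, f x) * ∫ x, g x)) :
    ∃ b, ∫ x, |f x - m (x + b)| ≤ 1200 * ε ^ (1 / 3 : ℝ) * ∫ x, m x ∧
      ∫ x, |g x - m (x - b)| ≤ 1200 * ε ^ (1 / 3 : ℝ) * ∫ x, m x := by
  obtain ⟨bf, bg, bm⟩ := HasBoundedLevels.of_mul_le_sq hm0 hmi hc h hf hg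
  obtain ⟨hAG, hst⟩ := half_add_le_integral_and_stability hm0 hf0 hg0 hmi hfi hgi hf1 hg1 bf bg bm
    hc h
  have I0 : 0 ≤ ∫ x, m x := integral_nonneg hm0
  have f0 : 0 ≤ ∫ x, f x := integral_nonneg hf0
  have g0 : 0 ≤ ∫ x, g x := integral_nonneg hg0
  rcases le_or_gt ε (1 / 4) with hε | hε
  · obtain ⟨b, h1, h2⟩ := hst ε ε0 hε hI
    have hle : √ε ≤ ε ^ (1 / 3 : ℝ) := by
      rw [Real.sqrt_eq_rpow]
      exact Real.rpow_le_rpow_of_exponent_ge ε0 (by linarith) (by norm_num)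
    have : 1200 * √ε * ∫ x, m x ≤ 1200 * ε ^ (1 / 3 : ℝ) * ∫ x, m x := by gcongr
    exact ⟨b, h1.trans this, h2.trans this⟩
  -- For large ε no shift is needed: each distance is at most 3 ∫m, because ∫f and ∫g are at most 2
  -- ∫m.
  · have hle : 1 / 4 ≤ ε ^ (1 / 3 : ℝ) := by
      calc (1 / 4 : ℝ) = (1 / 4 : ℝ) ^ (1 : ℝ) := (Real.rpow_one _).symm
        _ ≤ (1 / 4 : ℝ) ^ (1 / 3 : ℝ) :=
          Real.rpow_le_rpow_of_exponent_ge (by norm_num) (by norm_num) (by norm_num)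
        _ ≤ _ := Real.rpow_le_rpow (by norm_num) hε.le (by norm_num)
    have h3 := mul_le_mul_of_nonneg_right hle I0
    refine ⟨0, ?_, ?_⟩
    · simp only [add_zero]
      linarith [integral_abs_sub_le_integral_add hf0 hm0 hfi hmi]
    · simp only [sub_zero]
      linarith [integral_abs_sub_le_integral_add hg0 hm0 hgi hmi]

theorem exists_pos_of_integral_pos {f : ℝ → ℝ} (hpos : 0 < ∫ x, f x) : ∃ x, 0 < f x := by
  by_contra! hcon
  exact absurd hpos (not_lt.2 (integral_nonpos hcon))

theorem exists_sup_pos_of_integral_pos {f : ℝ → ℝ} (hpos : 0 < ∫ x, f x) {B : ℝ}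
    (hB : ∀ x, f x ≤ B) :
    ∃ α, 0 < α ∧ (∀ x, f x / α ≤ 1) ∧ ∀ t < 1, ∃ x, t < f x / α := by
  obtain ⟨x, hx⟩ := exists_pos_of_integral_pos hpos
  have hb : BddAbove (Set.range f) := ⟨B, by rintro _ ⟨y, rfl⟩; exact hB y⟩
  have hα : 0 < ⨆ y, f y := hx.trans_le (le_ciSup hb x)
  refine ⟨⨆ y, f y, hα, fun y => (div_le_one hα).2 (le_ciSup hb y), fun t ht => ?_⟩
  obtain ⟨y, hy⟩ := exists_lt_of_lt_ciSup (mul_lt_of_lt_one_left hα ht)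
  exact ⟨y, (lt_div_iff₀ hα).2 hy⟩

theorem integral_abs_sub_div_mul {f m : ℝ → ℝ} {α γ : ℝ} (hα : 0 < α) :
    ∫ x, |f x - α / γ * m x| = α * ∫ x, |f x / α - m x / γ| := by
  rw [← integral_const_mul]
  congr 1 with x
  rw [← abs_of_pos hα, ← abs_mul, abs_of_pos hα]
  congr 1
  field_simp

theorem theorem2 :
    ∃ c : ℝ, 0 < c ∧
      ∀ (m f g : ℝ → ℝ) (ε : ℝ),
        (∀ t, 0 ≤ m t) → (∀ t, 0 ≤ f t) → (∀ t, 0 ≤ g t) →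
        Integrable m volume → Integrable f volume → Integrable g volume →
        0 < ∫ t, m t → 0 < ∫ t, f t → 0 < ∫ t, g t →
        LogConcaveFun m →
        (∀ r s : ℝ, Real.sqrt (f r * g s) ≤ m ((r + s) / 2)) →
        0 < ε → (ε ≤ 1 / 2 ∨ 2 ≤ ε) →
        ∫ t, m t ≤ (1 + ε) * Real.sqrt ((∫ t, f t) * ∫ t, g t) →
        ∃ a b : ℝ, 0 < a ∧
          ∫ t, |f t - a * m (t + b)| ≤
            c * ε ^ (1 / 3 : ℝ) * |Real.log ε| ^ (4 / 3 : ℝ) * (a * ∫ t, m t) ∧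
          ∫ t, |g t - a⁻¹ * m (t - b)| ≤
            c * ε ^ (1 / 3 : ℝ) * |Real.log ε| ^ (4 / 3 : ℝ) * (a⁻¹ * ∫ t, m t) := by
  have hlog2 : 0 < Real.log 2 := Real.log_pos one_lt_two
  refine ⟨1200 / Real.log 2 ^ (4 / 3 : ℝ), by positivity, ?_⟩
  intro m f g ε hm0 hf0 hg0 hmi hfi hgi hmpos hfpos hgpos hmlc h ε0 hε hI
  -- Boundedness of m passes to f and g by fixing a point where the other function is positive, so
  -- their suprema α and β are finite.
  obtain ⟨B, hB⟩ := hmlc.exists_le hmi hmpos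
  have hmul (r s : ℝ) : f r * g s ≤ m ((r + s) / 2) ^ 2 := (Real.sqrt_le_left (hm0 _)).1 (h r s)
  have hmulB (r s : ℝ) : f r * g s ≤ B ^ 2 :=
    (hmul r s).trans (pow_le_pow_left₀ (hm0 _) (hB _) 2)
  obtain ⟨x₀, hx₀⟩ := exists_pos_of_integral_pos hfpos
  obtain ⟨y₀, hy₀⟩ := exists_pos_of_integral_pos hgpos
  obtain ⟨α, α0, hα1, hαt⟩ := exists_sup_pos_of_integral_pos hfpos (B := B ^ 2 / g y₀)
    fun x => (le_div_iff₀ hy₀).2 (hmulB x y₀)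
  obtain ⟨β, β0, hβ1, hβt⟩ := exists_sup_pos_of_integral_pos hgpos (B := B ^ 2 / f x₀)
    fun x => (le_div_iff₀ hx₀).2 (by rw [mul_comm]; exact hmulB x₀ x)
  set γ := √(α * β) with hγ
  have γ0 : 0 < γ := Real.sqrt_pos.2 (mul_pos α0 β0)
  have γsq : γ ^ 2 = α * β := Real.sq_sqrt (mul_pos α0 β0).le
  obtain ⟨b, h1, h2⟩ := exists_integral_abs_sub_le_of_sup_eq_one (m := fun x => m x / γ)
    (f := fun x => f x / α) (g := fun x => g x / β) (fun x => div_nonneg (hm0 x) γ0.le)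
    (fun x => div_nonneg (hf0 x) α0.le) (fun x => div_nonneg (hg0 x) β0.le) (hmi.div_const γ)
    (hfi.div_const α) (hgi.div_const β) hα1 hβ1 hαt hβt
    (fun t => by simpa only [lt_div_iff₀ γ0] using hmlc.ordConnected (t * γ))
    (fun r s => by
      rw [div_pow, γsq, div_mul_div_comm]
      exact div_le_div_of_nonneg_right (hmul r s) (mul_pos α0 β0).le) ε0 (by
      rw [integral_div, integral_div, integral_div, div_mul_div_comm,
        Real.sqrt_div (mul_pos hfpos hgpos).le, ← hγ, ← mul_div_assoc]
      exact div_le_div_of_nonneg_right hI γ0.le)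
  rw [integral_div] at h1 h2
  -- The excluded range of ε around 1 is what keeps |log ε| at least log 2.
  have hω : 1200 * ε ^ (1 / 3 : ℝ) ≤
      1200 / Real.log 2 ^ (4 / 3 : ℝ) * ε ^ (1 / 3 : ℝ) * |Real.log ε| ^ (4 / 3 : ℝ) := by
    have hl : Real.log 2 ≤ |Real.log ε| := by
      rcases hε with hε | hε
      · have := Real.log_le_log ε0 hε
        rw [one_div, Real.log_inv] at this
        exact le_trans (by linarith) (neg_le_abs _)
      · exact (Real.log_le_log two_pos hε).trans (le_abs_self _)
    have := Real.rpow_le_rpow hlog2.le hl (show (0 : ℝ) ≤ 4 / 3 by norm_num)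
    rw [div_mul_eq_mul_div, div_mul_eq_mul_div, le_div_iff₀ (by positivity)]
    gcongr
  have hainv : (α / γ)⁻¹ = β / γ := by
    rw [inv_div, div_eq_div_iff α0.ne' γ0.ne']
    linarith
  refine ⟨α / γ, b, div_pos α0 γ0, ?_, ?_⟩
  · calc _ = α * ∫ t, |f t / α - m (t + b) / γ| := integral_abs_sub_div_mul α0
      _ ≤ α * (1200 * ε ^ (1 / 3 : ℝ) * ((∫ t, m t) / γ)) := by gcongr
      _ = 1200 * ε ^ (1 / 3 : ℝ) * (α / γ * ∫ t, m t) := by ring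
      _ ≤ _ := by gcongr
  · rw [hainv]
    calc _ = β * ∫ t, |g t / β - m (t - b) / γ| := integral_abs_sub_div_mul β0
      _ ≤ β * (1200 * ε ^ (1 / 3 : ℝ) * ((∫ t, m t) / γ)) := by gcongr
      _ = 1200 * ε ^ (1 / 3 : ℝ) * (β / γ * ∫ t, m t) := by ring
      _ ≤ _ := by gcongr
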